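/- **Two dimensional comparison theorem.** Let $\Omega\subset\mathbb R^2$ be a polygonal domain (open, connected) with a finite conforming triangulation $\mathcal T$ such that $\partial\Omega$ is a union of edges of $\mathcal T$; let $\Gamma_D\subseteq\partial\Omega$ be a union of closed boundary edges of positive length, and $\Gamma_N=\partial\Omega\setminus\Gamma_D$. Let $\mathcal V$ be the space of functions on $\overline\Omega$ that are affine on each (closed) triangle $T\in\mathcal T$ and vanish on $\Gamma_D$, and let $\mathcal V^+=\{v\in\mathcal V: v\ge 0\}$. Assume that there are $0<t_{\min}\le t_{\max}<\pi/2$ such that all interior angles of all $T\in\mathcal T$ lie in $[t_{\min},t_{\max}]$; put $c_{\min}=\cos t_{\max}$. For $T\in\mathcal T$ with angles $\theta_1,\theta_2,\theta_3$, vertices $a_1,a_2,a_3$ and area $|T|$, put $$c_T=\min_i\cos\theta_i,\qquad s_T=\max_i\sin\theta_i,\qquad r_T=\min_{i,j}\frac{\sin\theta_i}{\sin\theta_j},\qquad \delta_T(\phi)=\max_{i,j}|\phi(a_i)-\phi(a_j)|.$$ *Coefficients.* Let $A:\Omega\times\mathbb R\times\mathbb R^2\to\mathbb R$, $a(x,\eta,\xi)=A(x,\eta,\xi)\xi$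 and $b:\Omega\times\mathbb R\to\mathbb R$, where $a$ and $b$ are measurable in $x$ for every $(\eta,\xi)$, respectively $\eta$, and, for a.e. $x\in\Omega$, $C^1$ in $(\eta,\xi)$, respectively $\eta$. Assume that there are constants $\gamma_a>0$, $K_\eta>0$, $B_\eta\ge0$ such that, for a.e. $x\in\Omega$ and all $\eta\in\mathbb R$, $\xi,\zeta\in\mathbb R^2$, $$\sum_{i,j}\frac{\partial a_i}{\partial\xi_j}(x,\eta,\xi)\zeta_i\zeta_j\ge\gamma_a|\zeta|^2,\qquad \left|\frac{\partial A}{\partial\eta}(x,\eta,\xi)\right|\le K_\eta,\qquad 0\le\frac{\partial b}{\partial\eta}(x,\eta)\le B_\eta$$ (in particular $A$ is differentiable in $\eta$). Assume that $$A(x,\eta,\xi)=A_0(x,\eta)+A_1(x,\eta)f(|\xi|)+A_2(x)g(|\xi|),$$ with constants $\lambda_0>0$, $\Lambda_1,\Lambda_2\ge0$ such that $A_0(x,\eta)\ge\lambda_0$, $0\le A_1(x,\eta)\le\Lambda_1$, $0\le A_2(x)\le\Lambda_2$ for a.e. $x\in\Omega$ and all $\eta\in\mathbb R$; that $f,g\ge0$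 on $[0,\infty)$, $f$ and $g$ are differentiable on $(0,\infty)$, and $s|f'(s)|\le C_f$, $s|g'(s)|\le C_g$ for all $s\geq 0$ (the bounds at $s=0$ reading $0\le C_f$, $0\le C_g$); and that $$\lambda_0c_{\min}-\Lambda_1C_f-\Lambda_2C_g>0.$$ *Discrete problem.* Let $\psi$ be bounded and measurable on $\Gamma_N$. For $u,v\in\mathcal V$ put $$R(u;v)=\int_\Omega\big(a(x,u,\nabla u)\cdot\nabla v+b(x,u)v\big)\,dx-\int_{\Gamma_N}\psi v\,ds.$$ Call $u\in\mathcal V$ a discrete subsolution (supersolution) if for all $v\in\mathcal V^+$ the integrand over $\Omega$ is integrable and $R(u;v)\le0$ ($R(u;v)\ge0$), and a discrete solution if for all $v\in\mathcal V$ the integrand over $\Omega$ is integrable and $R(u;v)=0$. With $p_T^*=\min\{\lambda_0c_T-\Lambda_1C_f-\Lambda_2C_g,\ \gamma_a/r_T\}$, consider for $u\in\mathcal V$ the condition $$\min_{T\in\mathcal T}\left\{p_T^*-\delta_T(u)\frac{7K_\eta(1+r_T^{-1})}{6}-\frac{7B_\eta|T|s_T}{3}\right\}>0.\tag{M}$$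 1. If $u_1$ is a discrete subsolution, $u_2$ is a discrete supersolution and $u=u_2$ satisfies (M), then $u_1\le u_2$ in $\Omega$. 2. If $u$ is a discrete solution that satisfies (M), then it is the only discrete solution: every discrete solution $u'$ equals $u$ in $\Omega$. -/

import Mathlib

open MeasureTheory Set

noncomputable section

namespace P1Comparison

/-- The Euclidean plane. -/
abbrev Plane := EuclideanSpace ℝ (Fin 2)

/-! ### Geometry of a single triangle -/

/-- The interior angle of the triangle `T` at its vertex number `i`. -/
def angle (T : Affine.Triangle ℝ Plane) (i : Fin 3) : ℝ :=
  EuclideanGeometry.angle (T.points (i + 1)) (T.points i) (T.points (i + 2))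

/-- The area of `T`. -/
def area (T : Affine.Triangle ℝ Plane) : ℝ := volume.real T.closedInterior

/-- `c_T`, the smallest cosine of an angle of `T`. -/
def cosMin (T : Affine.Triangle ℝ Plane) : ℝ :=
  Finset.univ.inf' Finset.univ_nonempty fun i : Fin 3 => Real.cos (angle T i)

/-- `s_T`, the largest sine of an angle of `T`. -/
def sinMax (T : Affine.Triangle ℝ Plane) : ℝ :=
  Finset.univ.sup' Finset.univ_nonempty fun i : Fin 3 => Real.sin (angle T i)

/-- `r_T`, the smallest ratio of the sines of two angles of `T`. -/
def sinRatio (T : Affine.Triangle ℝ Plane) : ℝ :=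
  Finset.univ.inf' Finset.univ_nonempty
    fun p : Fin 3 × Fin 3 => Real.sin (angle T p.1) / Real.sin (angle T p.2)

/-- `δ_T(φ)`, the largest difference between two vertex values of `φ` on `T`. -/
def vertexVariation (T : Affine.Triangle ℝ Plane) (φ : Plane → ℝ) : ℝ :=
  Finset.univ.sup' Finset.univ_nonempty
    fun p : Fin 3 × Fin 3 => |φ (T.points p.1) - φ (T.points p.2)|

/-! ### The mesh and the finite element space -/

/-- The (closed) edges of triangles of `𝒯` that lie on the boundary of `Ω`. -/
def boundaryEdges (Ω : Set Plane) (𝒯 : Finset (Affine.Triangle ℝ Plane)) : Set (Set Plane) :=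
  {e | e ⊆ frontier Ω ∧
    ∃ T ∈ 𝒯, ∃ i j : Fin 3, i ≠ j ∧ e = segment ℝ (T.points i) (T.points j)}

/-- `𝒯` is a conforming triangulation of the polygonal domain `Ω`: the closed triangles cover the
closure of `Ω`, two of them meet exactly in the simplex spanned by their common vertices (nothing,
a vertex, an edge), and the boundary of `Ω` consists of edges of the mesh. -/
structure IsTriangulation (Ω : Set Plane) (𝒯 : Finset (Affine.Triangle ℝ Plane)) : Prop where
  isOpen : IsOpen Ω
  isConnected : IsConnected Ω
  cover : closure Ω = ⋃ T ∈ 𝒯, T.closedInterior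
  conforming : ∀ T ∈ 𝒯, ∀ T' ∈ 𝒯,
    T.closedInterior ∩ T'.closedInterior = convexHull ℝ (range T.points ∩ range T'.points)
  boundary : frontier Ω = ⋃₀ boundaryEdges Ω 𝒯

/-- `ΓD` is a part of the boundary of positive length that is captured by the mesh, that is, a
union of closed boundary edges. -/
structure IsDirichletPart (Ω : Set Plane) (𝒯 : Finset (Affine.Triangle ℝ Plane))
    (ΓD : Set Plane) : Prop where
  captured : ∃ ℰ ⊆ boundaryEdges Ω 𝒯, ΓD = ⋃₀ ℰ
  pos : 0 < μH[1] ΓD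

/-- All interior angles of all triangles lie between `tmin` and `tmax`, where
`0 < tmin ≤ tmax < π / 2`. -/
structure MeshRegular (𝒯 : Finset (Affine.Triangle ℝ Plane)) (tmin tmax : ℝ) : Prop where
  tmin_pos : 0 < tmin
  tmin_le_tmax : tmin ≤ tmax
  tmax_lt : tmax < Real.pi / 2
  angles : ∀ T ∈ 𝒯, ∀ i, tmin ≤ angle T i ∧ angle T i ≤ tmax

/-- The `P1` Lagrange finite element space: functions that are affine on every closed triangle
(hence continuous on the closure of `Ω`) and vanish on `ΓD`.
Values outside the closure of `Ω` are irrelevant. -/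
def FESpace (𝒯 : Finset (Affine.Triangle ℝ Plane)) (ΓD : Set Plane) : Set (Plane → ℝ) :=
  {φ | (∀ T ∈ 𝒯, ∃ L : Plane →ᵃ[ℝ] ℝ, ∀ x ∈ T.closedInterior, φ x = L x) ∧ ∀ x ∈ ΓD, φ x = 0}

/-- The nonnegative functions of the finite element space. -/
def FESpaceNonneg (Ω : Set Plane) (𝒯 : Finset (Affine.Triangle ℝ Plane)) (ΓD : Set Plane) :
    Set (Plane → ℝ) :=
  {φ | φ ∈ FESpace 𝒯 ΓD ∧ ∀ x ∈ Ω, 0 ≤ φ x}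

/-! ### The discrete problem -/

/-- `a(x, η, ξ) = A(x, η, ξ) ξ`. -/
def flux (A : Plane → ℝ → Plane → ℝ) (x : Plane) (η : ℝ) (ξ : Plane) : Plane := A x η ξ • ξ

/-- `a(x, u, ∇u) · ∇v + b(x, u) v`. The gradient of a function of the finite element space exists
at every point of `Ω` off the edges of the mesh, hence almost everywhere in `Ω`. -/
def weakIntegrand (A : Plane → ℝ → Plane → ℝ) (b : Plane → ℝ → ℝ) (u v : Plane → ℝ)
    (x : Plane) : ℝ :=
  inner ℝ (flux A x (u x) (gradient u x)) (gradient v x) + b x (u x) * v x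

/-- The left side of the weak form minus the right side; the Neumann part of the boundary is
`frontier Ω \ ΓD`, and `ds` is the one-dimensional Hausdorff measure, that is, arc length. -/
def residual (Ω ΓD : Set Plane) (A : Plane → ℝ → Plane → ℝ) (b : Plane → ℝ → ℝ)
    (ψ : Plane → ℝ) (u v : Plane → ℝ) : ℝ :=
  (∫ x in Ω, weakIntegrand A b u v x) - ∫ x in frontier Ω \ ΓD, ψ x * v x ∂μH[1]

/-- Discrete subsolutions (the integrals of the definition are required to exist). -/
def IsSubsolution (Ω : Set Plane) (𝒯 : Finset (Affine.Triangle ℝ Plane)) (ΓD : Set Plane)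
    (A : Plane → ℝ → Plane → ℝ) (b : Plane → ℝ → ℝ) (ψ : Plane → ℝ) (u : Plane → ℝ) : Prop :=
  u ∈ FESpace 𝒯 ΓD ∧ ∀ v ∈ FESpaceNonneg Ω 𝒯 ΓD,
    IntegrableOn (weakIntegrand A b u v) Ω ∧ residual Ω ΓD A b ψ u v ≤ 0

/-- Discrete supersolutions (the integrals of the definition are required to exist). -/
def IsSupersolution (Ω : Set Plane) (𝒯 : Finset (Affine.Triangle ℝ Plane)) (ΓD : Set Plane)
    (A : Plane → ℝ → Plane → ℝ) (b : Plane → ℝ → ℝ) (ψ : Plane → ℝ) (u : Plane → ℝ) : Prop :=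
  u ∈ FESpace 𝒯 ΓD ∧ ∀ v ∈ FESpaceNonneg Ω 𝒯 ΓD,
    IntegrableOn (weakIntegrand A b u v) Ω ∧ 0 ≤ residual Ω ΓD A b ψ u v

/-- Discrete solutions (the integrals of the definition are required to exist). -/
def IsDiscreteSolution (Ω : Set Plane) (𝒯 : Finset (Affine.Triangle ℝ Plane)) (ΓD : Set Plane)
    (A : Plane → ℝ → Plane → ℝ) (b : Plane → ℝ → ℝ) (ψ : Plane → ℝ) (u : Plane → ℝ) : Prop :=
  u ∈ FESpace 𝒯 ΓD ∧ ∀ v ∈ FESpace 𝒯 ΓD,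
    IntegrableOn (weakIntegrand A b u v) Ω ∧ residual Ω ΓD A b ψ u v = 0

/-! ### Assumptions on the coefficients -/

/-- The general assumptions on `a(x, η, ξ) = A(x, η, ξ) ξ` and `b`: Carathéodory functions, `C¹` in
`(η, ξ)` and in `η`; ellipticity with constant `γa`; `|∂A/∂η| ≤ Kη`; `0 ≤ ∂b/∂η ≤ Bη`. -/
structure CoefficientAssumptions (Ω : Set Plane) (A : Plane → ℝ → Plane → ℝ)
    (b : Plane → ℝ → ℝ) (γa Kη Bη : ℝ) : Prop where
  γa_pos : 0 < γa
  Kη_pos : 0 < Kη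
  Bη_nonneg : 0 ≤ Bη
  flux_measurable : ∀ η ξ, AEMeasurable (fun x => flux A x η ξ) (volume.restrict Ω)
  b_measurable : ∀ η, AEMeasurable (fun x => b x η) (volume.restrict Ω)
  flux_contDiff : ∀ᵐ x ∂volume.restrict Ω, ContDiff ℝ 1 fun p : ℝ × Plane => flux A x p.1 p.2
  b_contDiff : ∀ᵐ x ∂volume.restrict Ω, ContDiff ℝ 1 (b x)
  elliptic : ∀ᵐ x ∂volume.restrict Ω, ∀ (η : ℝ) (ξ ζ : Plane),
    γa * ‖ζ‖ ^ 2 ≤ inner ℝ (fderiv ℝ (flux A x η) ξ ζ) ζ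
  A_deriv : ∀ᵐ x ∂volume.restrict Ω, ∀ (η : ℝ) (ξ : Plane),
    DifferentiableAt ℝ (fun t => A x t ξ) η ∧ |deriv (fun t => A x t ξ) η| ≤ Kη
  b_deriv : ∀ᵐ x ∂volume.restrict Ω, ∀ η : ℝ, 0 ≤ deriv (b x) η ∧ deriv (b x) η ≤ Bη

/-- The structure `A(x, η, ξ) = A₀(x, η) + A₁(x, η) f(|ξ|) + A₂(x) g(|ξ|)` of the diffusion
coefficient with `A₀ ≥ lam₀ > 0`, `0 ≤ A₁ ≤ Λ₁`, `0 ≤ A₂ ≤ Λ₂`, nonnegative `f` and `g` on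
`[0, ∞)`, `s |f'(s)| ≤ Cf` and `s |g'(s)| ≤ Cg`. As the last two bounds carry no information on the
derivatives at `s = 0`, differentiability is only asked for at `s > 0`. -/
structure DiffusionForm (Ω : Set Plane) (A : Plane → ℝ → Plane → ℝ)
    (A₀ A₁ : Plane → ℝ → ℝ) (A₂ : Plane → ℝ) (f g : ℝ → ℝ)
    (lam₀ Λ₁ Λ₂ Cf Cg : ℝ) : Prop where
  decomp : ∀ x ∈ Ω, ∀ (η : ℝ) (ξ : Plane),
    A x η ξ = A₀ x η + A₁ x η * f ‖ξ‖ + A₂ x * g ‖ξ‖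
  lam₀_pos : 0 < lam₀
  Λ₁_nonneg : 0 ≤ Λ₁
  Λ₂_nonneg : 0 ≤ Λ₂
  A₀_bound : ∀ᵐ x ∂volume.restrict Ω, ∀ η : ℝ, lam₀ ≤ A₀ x η
  A₁_bound : ∀ᵐ x ∂volume.restrict Ω, ∀ η : ℝ, 0 ≤ A₁ x η ∧ A₁ x η ≤ Λ₁
  A₂_bound : ∀ᵐ x ∂volume.restrict Ω, 0 ≤ A₂ x ∧ A₂ x ≤ Λ₂
  f_nonneg : ∀ s, 0 ≤ s → 0 ≤ f s
  g_nonneg : ∀ s, 0 ≤ s → 0 ≤ g s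
  f_differentiable : ∀ s, 0 < s → DifferentiableAt ℝ f s
  g_differentiable : ∀ s, 0 < s → DifferentiableAt ℝ g s
  f_deriv : ∀ s, 0 ≤ s → s * |deriv f s| ≤ Cf
  g_deriv : ∀ s, 0 ≤ s → s * |deriv g s| ≤ Cg

/-! ### The mesh condition -/

/-- `p*_T = min {lam₀ c_T - Λ₁ Cf - Λ₂ Cg, γa / r_T}`. -/
def pStar (lam₀ Λ₁ Λ₂ Cf Cg γa : ℝ) (T : Affine.Triangle ℝ Plane) : ℝ :=
  min (lam₀ * cosMin T - Λ₁ * Cf - Λ₂ * Cg) (γa / sinRatio T)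

/-- The minimum over the (finitely many) triangles `T` of
`p*_T - δ_T(u) · 7 Kη (1 + r_T⁻¹) / 6 - 7 Bη |T| s_T / 3` is positive. -/
def MeshCondition (𝒯 : Finset (Affine.Triangle ℝ Plane)) (lam₀ Λ₁ Λ₂ Cf Cg γa Kη Bη : ℝ)
    (u : Plane → ℝ) : Prop :=
  ∀ T ∈ 𝒯, 0 < pStar lam₀ Λ₁ Λ₂ Cf Cg γa T
    - vertexVariation T u * (7 * Kη * (1 + (sinRatio T)⁻¹) / 6)
    - 7 * Bη * area T * sinMax T / 3

end P1Comparison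

end

open P1Comparison

/-! Test both inequalities with the finite element function `v` whose nodal values are 1 where `u₁ >
u₂` and 0 elsewhere. It is admissible, since it is nonnegative and both functions vanish on `ΓD`.
Subtracting, the integral over `Ω` of the difference of the two integrands is at most 0, because the
Neumann terms cancel. The point is that this difference is nonnegative almost everywhere, and
positive on every triangle where `v` is not constant.

Where `v` is constant, `∇v = 0` and only the monotone term `b` remains. Otherwise one vertex `k` is
separated from the other two by the sign of `w = u₁ - u₂`. Let `gi`, `gj` be the gradients of the
nodal basis functions of those two. Then `∇v = ±(gi + gj)` and `∇w = di • gi + dj • gj`, with `di`,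
`dj` of the same sign as in `∇v`. All angles being acute, `gi` and `gj` make acute angles with `gi +
gj` (`exists_nodal_gradients`), so the principal part with frozen `η` has a positive lower bound
proportional to `(|di| ‖gi‖ + |dj| ‖gj‖) ‖gi + gj‖` (`inner_radial_sub_lower`). The errors from the
dependence on `η` and from `b` are at most linear in `|w| ≤ |di| + |dj|`, and the mesh condition
absorbs them (`pos_of_mesh_condition`).

Hence `v` is constantly 0 or 1 on each triangle. By connectedness (`forall_zero_of_zero_or_one`) and
the Dirichlet condition it is 0, so `u₁ ≤ u₂` at all vertices and therefore everywhere. -/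

namespace P1Comparison

/-! ### Determinants and areas in the plane -/

/-- The determinant of two plane vectors. -/
def cross (a b : Plane) : ℝ := a 0 * b 1 - a 1 * b 0

/-- Rotation by a right angle. -/
def rot (z : Plane) : Plane := !₂[z 1, -z 0]

lemma Plane.inner_eq (x y : Plane) : inner ℝ x y = x 0 * y 0 + x 1 * y 1 := by
  simp [PiLp.inner_apply, Fin.sum_univ_two, mul_comm]

lemma Plane.ext' {x y : Plane} (h0 : x 0 = y 0) (h1 : x 1 = y 1) : x = y := by
  ext i; fin_cases i <;> assumption

lemma inner_rot_rot (x y : Plane) : inner ℝ (rot x) (rot y) = inner ℝ x y := by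
  simp [Plane.inner_eq, rot]; ring

lemma norm_rot (x : Plane) : ‖rot x‖ = ‖x‖ := by
  rw [norm_eq_sqrt_real_inner, norm_eq_sqrt_real_inner (F := Plane), inner_rot_rot]

lemma sin_angle_mul_norms (a b : Plane) :
    Real.sin (InnerProductGeometry.angle a b) * (‖a‖ * ‖b‖) = |cross a b| := by
  rw [InnerProductGeometry.sin_angle_mul_norm_mul_norm, ← Real.sqrt_sq_eq_abs]
  congr 1
  simp only [Plane.inner_eq, cross]; ring

lemma cross_ne_zero (T : Affine.Triangle ℝ Plane) (k : Fin 3) :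
    cross (T.points (k + 1) - T.points k) (T.points (k + 2) - T.points k) ≠ 0 := by
  have hnc : ¬ Collinear ℝ {T.points (k + 1), T.points k, T.points (k + 2)} := by
    rw [← affineIndependent_iff_not_collinear_of_ne (p := T.points)]
    · exact T.independent
    all_goals revert k; decide
  have hs := EuclideanGeometry.sin_pos_of_not_collinear hnc
  have h := sin_angle_mul_norms (T.points (k + 1) - T.points k) (T.points (k + 2) - T.points k)
  have h1 : 0 < ‖T.points (k + 1) - T.points k‖ := by
    rw [norm_pos_iff, sub_ne_zero]
    exact T.independent.injective.ne (by clear * -; revert k; decide)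
  have h2 : 0 < ‖T.points (k + 2) - T.points k‖ := by
    rw [norm_pos_iff, sub_ne_zero]
    exact T.independent.injective.ne (by clear * -; revert k; decide)
  rw [← abs_pos, ← h]
  exact mul_pos hs (mul_pos h1 h2)

lemma closedInterior_eq_hull (T : Affine.Triangle ℝ Plane) :
    T.closedInterior = convexHull ℝ (range T.points) :=
  (Affine.Simplex.convexHull_eq_closedInterior T).symm

lemma convex_closedInterior (T : Affine.Triangle ℝ Plane) : Convex ℝ T.closedInterior := by
  rw [closedInterior_eq_hull]; exact convex_convexHull _ _

/-- Convex combinations of the vertices belong to the triangle. -/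
lemma add_smul_mem_closedInterior (T : Affine.Triangle ℝ Plane) (k : Fin 3) {s t : ℝ}
    (hs : 0 ≤ s) (ht : 0 ≤ t) (hst : s + t ≤ 1) :
    T.points k + (s • (T.points (k + 1) - T.points k) + t • (T.points (k + 2) - T.points k))
      ∈ T.closedInterior := by
  have hc := convex_closedInterior T
  have hm := fun i => T.point_mem_closedInterior i
  have := hc.sum_mem (t := Finset.univ) (w := ![1 - s - t, s, t])
    (z := ![T.points k, T.points (k + 1), T.points (k + 2)])
    (by intro i _; fin_cases i <;> simp <;> linarith)
    (by simp [Fin.sum_univ_three]; ring)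
    (by intro i _; fin_cases i <;> simp [hm])
  convert this using 1
  simp [Fin.sum_univ_three]
  module

lemma volume_parallelepiped_pair (a b : Plane) :
    volume (parallelepiped ![a, b]) = ENNReal.ofReal |cross a b| := by
  rw [← (EuclideanSpace.basisFun (Fin 2) ℝ).addHaar_eq_volume, Measure.addHaar_parallelepiped,
    Module.Basis.det_apply, Matrix.det_fin_two]
  simp [Module.Basis.toMatrix_apply, cross]
  congr 2; ring

/-- A triangle fills at least half of the parallelogram that it spans. -/
lemma abs_cross_le_area (T : Affine.Triangle ℝ Plane) (k : Fin 3) :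
    |cross (T.points (k + 1) - T.points k) (T.points (k + 2) - T.points k)| ≤ 2 * area T := by
  set p := T.points k with hp
  set a := T.points (k + 1) - p with ha
  set b := T.points (k + 2) - p with hb
  have hfin : volume T.closedInterior ≠ ⊤ := T.isCompact_closedInterior.measure_ne_top
  -- The diagonal cuts the parallelogram into the triangle and its image under the point reflection
  -- `x ↦ p + a + b - x`, which preserves volume.
  have hsub : parallelepiped ![a, b] ⊆
      (fun x => p + x) ⁻¹' T.closedInterior ∪ (fun x => (p + a + b) - x) ⁻¹' T.closedInterior := by
    intro x hx
    rw [mem_parallelepiped_iff] at hx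
    obtain ⟨t, ht, rfl⟩ := hx
    have h0 := ht.1 0
    have h1 := ht.1 1
    have h2 := ht.2 0
    have h3 := ht.2 1
    simp only [Pi.zero_apply, Pi.one_apply] at h0 h1 h2 h3
    simp only [Fin.sum_univ_two, Matrix.cons_val_zero, Matrix.cons_val_one]
    by_cases h : t 0 + t 1 ≤ 1
    · exact Or.inl (add_smul_mem_closedInterior T k h0 h1 h)
    · right
      have := add_smul_mem_closedInterior T k (s := 1 - t 0) (t := 1 - t 1) (by linarith)
        (by linarith) (by linarith)
      simp only [mem_preimage]
      convert this using 1
      rw [← ha, ← hb]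
      module
  have hv : volume (parallelepiped ![a, b]) ≤ volume T.closedInterior + volume T.closedInterior := by
    refine (measure_mono hsub).trans ((measure_union_le _ _).trans (le_of_eq ?_))
    rw [measure_preimage_add, (Measure.measurePreserving_sub_left volume _).measure_preimage
      T.isClosed_closedInterior.measurableSet.nullMeasurableSet]
  rw [volume_parallelepiped_pair] at hv
  have := ENNReal.toReal_mono (by simp [hfin]) hv
  rw [ENNReal.toReal_ofReal (abs_nonneg _), ENNReal.toReal_add hfin hfin] at this
  simpa [area, Measure.real, two_mul] using this

/-! ### Angles of a triangle and gradients of the nodal basis -/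

lemma cosMin_le (T : Affine.Triangle ℝ Plane) (i : Fin 3) : cosMin T ≤ Real.cos (angle T i) :=
  Finset.inf'_le _ (Finset.mem_univ i)

lemma le_sinMax (T : Affine.Triangle ℝ Plane) (i : Fin 3) : Real.sin (angle T i) ≤ sinMax T :=
  Finset.le_sup' (fun i : Fin 3 => Real.sin (angle T i)) (Finset.mem_univ i)

lemma sinRatio_le (T : Affine.Triangle ℝ Plane) (i j : Fin 3) :
    sinRatio T ≤ Real.sin (angle T i) / Real.sin (angle T j) :=
  Finset.inf'_le (fun p : Fin 3 × Fin 3 => Real.sin (angle T p.1) / Real.sin (angle T p.2))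
    (Finset.mem_univ (i, j))

lemma le_vertexVariation (T : Affine.Triangle ℝ Plane) (φ : Plane → ℝ) (i j : Fin 3) :
    |φ (T.points i) - φ (T.points j)| ≤ vertexVariation T φ :=
  Finset.le_sup' (fun p : Fin 3 × Fin 3 => |φ (T.points p.1) - φ (T.points p.2)|)
    (Finset.mem_univ (i, j))

lemma angle_eq (T : Affine.Triangle ℝ Plane) (i : Fin 3) : angle T i =
    InnerProductGeometry.angle (T.points (i + 1) - T.points i) (T.points (i + 2) - T.points i) :=
  rfl

lemma sin_angle_pos (T : Affine.Triangle ℝ Plane) (i : Fin 3) : 0 < Real.sin (angle T i) := by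
  have h := sin_angle_mul_norms (T.points (i + 1) - T.points i) (T.points (i + 2) - T.points i)
  rw [← angle_eq] at h
  have h1 := abs_pos.2 (cross_ne_zero T i)
  rw [← h] at h1
  exact pos_of_mul_pos_left h1 (by positivity)

lemma sinRatio_pos (T : Affine.Triangle ℝ Plane) : 0 < sinRatio T := by
  rw [sinRatio, Finset.lt_inf'_iff]
  exact fun p _ => div_pos (sin_angle_pos T _) (sin_angle_pos T _)

/-- The gradients `gi`, `gj` of the nodal basis functions of the vertices other than `k`, with
`-(gi + gj)` the one of the vertex `k`, and their geometry. -/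
lemma exists_nodal_gradients (T : Affine.Triangle ℝ Plane) (k : Fin 3) : ∃ gi gj : Plane,
    (∀ ξ : Plane, ξ = inner ℝ ξ (T.points (k + 1) - T.points k) • gi
      + inner ℝ ξ (T.points (k + 2) - T.points k) • gj) ∧
    (0 < ‖gi‖ ∧ 0 < ‖gj‖ ∧ 0 < ‖gi + gj‖) ∧
    (cosMin T * (‖gi‖ * ‖gi + gj‖) ≤ inner ℝ gi (gi + gj) ∧
      cosMin T * (‖gj‖ * ‖gi + gj‖) ≤ inner ℝ gj (gi + gj)) ∧
    (sinRatio T * ‖gi‖ ≤ ‖gj‖ ∧ sinRatio T * ‖gj‖ ≤ ‖gi‖) ∧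
    (1 ≤ 2 * area T * sinMax T * (‖gi‖ * ‖gi + gj‖) ∧
      1 ≤ 2 * area T * sinMax T * (‖gj‖ * ‖gi + gj‖)) := by
  have hD := cross_ne_zero T k
  have hA := abs_cross_le_area T k
  have hk1 : k + 1 + 1 = k + 2 := by clear * -; revert k; decide
  have hk2 : k + 1 + 2 = k := by clear * -; revert k; decide
  have hk3 : k + 2 + 1 = k := by clear * -; revert k; decide
  have hk4 : k + 2 + 2 = k + 1 := by clear * -; revert k; decide
  have hI := angle_eq T (k + 1)
  have hJ := angle_eq T (k + 2)
  rw [hk1, hk2] at hI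
  rw [hk3, hk4] at hJ
  set p := T.points k with hp
  set a := T.points (k + 1) - p with ha
  set b := T.points (k + 2) - p with hb
  set D := cross a b with hDdef
  have eI : T.points (k + 2) - T.points (k + 1) = b - a := by rw [ha, hb]; abel
  have eI' : p - T.points (k + 1) = -a := by rw [ha]; abel
  have eJ : T.points (k + 1) - T.points (k + 2) = a - b := by rw [ha, hb]; abel
  have eJ' : p - T.points (k + 2) = -b := by rw [hb]; abel
  rw [eI, eI'] at hI
  rw [eJ, eJ'] at hJ
  have sI := sin_angle_mul_norms (b - a) (-a)
  have sJ := sin_angle_mul_norms (-b) (a - b)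
  have cI : cross (b - a) (-a) = D := by simp [hDdef, cross]; ring
  have cJ : cross (-b) (a - b) = D := by simp [hDdef, cross]; ring
  rw [← hI, cI, norm_neg] at sI
  rw [← hJ, cJ, norm_neg, norm_sub_rev a b] at sJ
  have kI := InnerProductGeometry.cos_angle_mul_norm_mul_norm (b - a) (-a)
  have kJ := InnerProductGeometry.cos_angle_mul_norm_mul_norm (-b) (a - b)
  rw [← hI, norm_neg] at kI
  rw [← hJ, norm_neg, norm_sub_rev a b] at kJ
  have pI := sin_angle_pos T (k + 1)
  have pJ := sin_angle_pos T (k + 2)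
  have mI := le_sinMax T (k + 1)
  have mJ := le_sinMax T (k + 2)
  have oI := cosMin_le T (k + 1)
  have oJ := cosMin_le T (k + 2)
  have rIJ := sinRatio_le T (k + 1) (k + 2)
  have rJI := sinRatio_le T (k + 2) (k + 1)
  have hA0 : 0 ≤ 2 * area T := (abs_nonneg D).trans hA
  have hq : 0 < |D| := abs_pos.2 hD
  have na : 0 < ‖a‖ := by
    rw [norm_pos_iff]; rintro h; simp [hDdef, cross, h] at hD
  have nb : 0 < ‖b‖ := by
    rw [norm_pos_iff]; rintro h; simp [hDdef, cross, h] at hD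
  have nc : 0 < ‖b - a‖ := by
    rw [norm_pos_iff]; rintro h; rw [h] at cI; simp [cross] at cI; exact hD cI.symm
  have hgi : ‖D⁻¹ • rot b‖ = ‖b‖ / |D| := by
    rw [norm_smul, norm_rot, norm_inv, Real.norm_eq_abs]; ring
  have hgj : ‖-(D⁻¹ • rot a)‖ = ‖a‖ / |D| := by
    rw [norm_neg, norm_smul, norm_rot, norm_inv, Real.norm_eq_abs]; ring
  have hsum : D⁻¹ • rot b + -(D⁻¹ • rot a) = D⁻¹ • rot (b - a) := by
    apply Plane.ext' <;> simp [rot] <;> ring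
  have hgk : ‖D⁻¹ • rot (b - a)‖ = ‖b - a‖ / |D| := by
    rw [norm_smul, norm_rot, norm_inv, Real.norm_eq_abs]; ring
  have hDD : D⁻¹ * D⁻¹ = 1 / (|D| * |D|) := by
    rw [abs_mul_abs_self]; field_simp
  -- Nodal gradients are normal to the opposite edges: these two vectors form the dual basis of the
  -- edge vectors `a`, `b`. As rotated and rescaled edges, they inherit the lengths and angles of
  -- the triangle up to the factor `1 / |D|`.
  refine ⟨D⁻¹ • rot b, -(D⁻¹ • rot a), ?_, ?_, ?_, ?_, ?_⟩
  · intro ξ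
    apply Plane.ext' <;> simp only [Plane.inner_eq, rot, PiLp.add_apply, PiLp.smul_apply,
      PiLp.neg_apply, smul_eq_mul, Matrix.cons_val_zero, Matrix.cons_val_one] <;> field_simp <;>
      simp only [hDdef, cross] <;> ring
  · rw [hsum, hgi, hgj, hgk]
    exact ⟨by positivity, by positivity, by positivity⟩
  · rw [hsum, hgi, hgj, hgk, inner_neg_left]
    simp only [real_inner_smul_left, real_inner_smul_right, inner_rot_rot]
    have e1 : inner ℝ b (b - a) = Real.cos (angle T (k + 2)) * (‖b‖ * ‖b - a‖) := by
      rw [kJ, inner_neg_left, ← inner_neg_right, neg_sub]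
    have e2 : -inner ℝ a (b - a) = Real.cos (angle T (k + 1)) * (‖b - a‖ * ‖a‖) := by
      rw [kI, inner_neg_right, real_inner_comm]
    constructor
    · calc _ = (cosMin T * (‖b‖ * ‖b - a‖)) * (1 / (|D| * |D|)) := by field_simp
        _ ≤ (Real.cos (angle T (k + 2)) * (‖b‖ * ‖b - a‖)) * (1 / (|D| * |D|)) := by gcongr
        _ = _ := by rw [← e1, ← hDD]; ring
    · calc _ = (cosMin T * (‖b - a‖ * ‖a‖)) * (1 / (|D| * |D|)) := by field_simp
        _ ≤ (Real.cos (angle T (k + 1)) * (‖b - a‖ * ‖a‖)) * (1 / (|D| * |D|)) := by gcongr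
        _ = _ := by rw [← e2, ← hDD]; ring
  · rw [hgi, hgj]
    rw [le_div_iff₀ pJ] at rIJ
    rw [le_div_iff₀ pI] at rJI
    -- The law of sines, in the form that `sI` and `sJ` both evaluate to `|D|`.
    have i1 : sinRatio T * ‖b‖ ≤ ‖a‖ := by
      refine le_of_mul_le_mul_right ?_ (mul_pos pI nc)
      calc sinRatio T * ‖b‖ * (Real.sin (angle T (k + 1)) * ‖b - a‖)
          = (sinRatio T * Real.sin (angle T (k + 1))) * (‖b‖ * ‖b - a‖) := by ring
        _ ≤ Real.sin (angle T (k + 2)) * (‖b‖ * ‖b - a‖) := by gcongr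
        _ = _ := by rw [sJ, ← sI]; ring
    have i2 : sinRatio T * ‖a‖ ≤ ‖b‖ := by
      refine le_of_mul_le_mul_right ?_ (mul_pos pJ nc)
      calc sinRatio T * ‖a‖ * (Real.sin (angle T (k + 2)) * ‖b - a‖)
          = (sinRatio T * Real.sin (angle T (k + 2))) * (‖b - a‖ * ‖a‖) := by ring
        _ ≤ Real.sin (angle T (k + 1)) * (‖b - a‖ * ‖a‖) := by gcongr
        _ = _ := by rw [sI, ← sJ]; ring
    constructor
    · rw [← mul_div_assoc]; gcongr
    · rw [← mul_div_assoc]; gcongr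
  · rw [hsum, hgi, hgj, hgk]
    constructor
    -- Twice the area is at least `|D|`, and `|D|` is the product of two sides and the sine between
    -- them, so the powers of `|D|` cancel.
    · calc (1 : ℝ) = |D| * Real.sin (angle T (k + 2)) * (‖b‖ / |D| * (‖b - a‖ / |D|)) := by
            field_simp; linear_combination -sJ
        _ ≤ _ := by gcongr
    · calc (1 : ℝ) = |D| * Real.sin (angle T (k + 1)) * (‖a‖ / |D| * (‖b - a‖ / |D|)) := by
            field_simp; linear_combination -sI
        _ ≤ _ := by gcongr

/-! ### Monotonicity of radial fluxes -/

/-- Derivative of a radial flux `h(|ξ|) ξ` off the origin. -/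
lemma inner_fderiv_radial_lower_of_ne {F : Plane → Plane} {h : ℝ → ℝ} {lam C : ℝ}
    (hF : Differentiable ℝ F) (hFh : ∀ ξ, F ξ = h ‖ξ‖ • ξ) (hlow : ∀ s, 0 ≤ s → lam ≤ h s)
    (hdiff : ∀ s, 0 < s → DifferentiableAt ℝ h s) (hder : ∀ s, 0 < s → s * |deriv h s| ≤ C)
    {ξ ω ζ : Plane} (hξ : ξ ≠ 0) (hωζ : 0 ≤ inner ℝ ω ζ) :
    lam * inner ℝ ω ζ - C * (‖ω‖ * ‖ζ‖) ≤ inner ℝ (fderiv ℝ F ξ ω) ζ := by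
  have hn : 0 < ‖ξ‖ := norm_pos_iff.2 hξ
  have hline : HasDerivAt (fun t : ℝ => ξ + t • ω) ω 0 := by
    simpa using ((hasDerivAt_id (0 : ℝ)).smul_const ω).const_add ξ
  have h1 : HasDerivAt (fun t : ℝ => F (ξ + t • ω)) (fderiv ℝ F ξ ω) 0 := by
    have := (hF (ξ + (0 : ℝ) • ω)).hasFDerivAt.comp_hasDerivAt (0 : ℝ) hline
    rw [zero_smul, add_zero] at this
    exact this
  have hnorm : HasDerivAt (fun t : ℝ => ‖ξ + t • ω‖) (inner ℝ ξ ω / ‖ξ‖) 0 := by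
    have h2 := hline.norm_sq.sqrt (by simpa using hn.ne')
    have e : (fun t : ℝ => ‖ξ + t • ω‖) = fun t : ℝ => √(‖ξ + t • ω‖ ^ 2) := by
      ext t; rw [Real.sqrt_sq (norm_nonneg _)]
    rw [e]
    convert h2 using 1
    simp only [zero_smul, add_zero, Real.sqrt_sq hn.le]
    field_simp
  have hh : HasDerivAt (fun t : ℝ => h ‖ξ + t • ω‖) (deriv h ‖ξ‖ * (inner ℝ ξ ω / ‖ξ‖)) 0 := by
    have := (hdiff ‖ξ + (0 : ℝ) • ω‖ (by simpa using hn)).hasDerivAt.comp (0 : ℝ) hnorm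
    simpa [Function.comp_def] using this
  have h3 := hh.smul hline
  have h4 := h1.unique (h3.congr_of_eventuallyEq (Filter.Eventually.of_forall fun t => by
    simp [hFh]))
  rw [h4]
  -- The derivative is `h(|ξ|) ω` plus the rank-one term `h'(|ξ|) (ξ·ω / |ξ|) ξ`; the latter is
  -- controlled by `|ξ| |h'(|ξ|)| ≤ C` whatever the direction of `ξ`.
  simp only [zero_smul, add_zero, inner_add_left, real_inner_smul_left]
  have b1 := hlow ‖ξ‖ hn.le
  have b2 := hder ‖ξ‖ hn
  have c1 := abs_real_inner_le_norm ξ ω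
  have c2 := abs_real_inner_le_norm ξ ζ
  have b3 : |deriv h ‖ξ‖ * (inner ℝ ξ ω / ‖ξ‖) * inner ℝ ξ ζ| ≤ C * (‖ω‖ * ‖ζ‖) := by
    rw [abs_mul, abs_mul, abs_div, abs_norm]
    calc _ ≤ |deriv h ‖ξ‖| * (‖ξ‖ * ‖ω‖ / ‖ξ‖) * (‖ξ‖ * ‖ζ‖) := by gcongr
      _ = ‖ξ‖ * |deriv h ‖ξ‖| * (‖ω‖ * ‖ζ‖) := by field_simp
      _ ≤ _ := by gcongr
  have b4 := mul_le_mul_of_nonneg_right b1 hωζ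
  have b5 := (abs_le.1 b3).1
  linarith

/-- `h` need not be differentiable at 0, but `F` is `C¹`, so the inequality extends from the dense
set `ξ ≠ 0` by continuity. -/
lemma inner_fderiv_radial_lower {F : Plane → Plane} {h : ℝ → ℝ} {lam C : ℝ}
    (hF : ContDiff ℝ 1 F) (hFh : ∀ ξ, F ξ = h ‖ξ‖ • ξ) (hlow : ∀ s, 0 ≤ s → lam ≤ h s)
    (hdiff : ∀ s, 0 < s → DifferentiableAt ℝ h s) (hder : ∀ s, 0 < s → s * |deriv h s| ≤ C)
    (ξ : Plane) {ω ζ : Plane} (hωζ : 0 ≤ inner ℝ ω ζ) :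
    lam * inner ℝ ω ζ - C * (‖ω‖ * ‖ζ‖) ≤ inner ℝ (fderiv ℝ F ξ ω) ζ := by
  have hcont : Continuous fun ξ => inner ℝ (fderiv ℝ F ξ ω) ζ :=
    ((hF.continuous_fderiv (by simp)).clm_apply continuous_const).inner continuous_const
  have hcl : IsClosed {ξ | lam * inner ℝ ω ζ - C * (‖ω‖ * ‖ζ‖) ≤ inner ℝ (fderiv ℝ F ξ ω) ζ} :=
    isClosed_le continuous_const hcont
  have hd : Dense ({0}ᶜ : Set Plane) := dense_compl_singleton 0
  have := hcl.closure_subset_iff.2 (fun ξ hξ => inner_fderiv_radial_lower_of_ne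
    (hF.differentiable (by simp)) hFh hlow hdiff hder hξ hωζ : ({0}ᶜ : Set Plane) ⊆ _)
  exact this (hd ξ)

/-- Off-diagonal monotonicity of a radial flux, for increments that are nonnegative combinations of
directions `gi`, `gj` making a uniformly acute angle with `h`. -/
lemma inner_radial_sub_lower {F : Plane → Plane} {h : ℝ → ℝ} {lam C c : ℝ} (hlam : 0 ≤ lam)
    (hc : 0 ≤ c)
    (hF : ContDiff ℝ 1 F) (hFh : ∀ ξ, F ξ = h ‖ξ‖ • ξ) (hlow : ∀ s, 0 ≤ s → lam ≤ h s)
    (hdiff : ∀ s, 0 < s → DifferentiableAt ℝ h s) (hder : ∀ s, 0 < s → s * |deriv h s| ≤ C)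
    {gi gj e : Plane} (hi : c * (‖gi‖ * ‖e‖) ≤ inner ℝ gi e)
    (hj : c * (‖gj‖ * ‖e‖) ≤ inner ℝ gj e) {σ di dj : ℝ}
    (hdi : σ * di = |di|) (hdj : σ * dj = |dj|) {ξ₁ ξ₂ : Plane}
    (hξ : ξ₁ - ξ₂ = di • gi + dj • gj) :
    (lam * c - C) * ((|di| * ‖gi‖ + |dj| * ‖gj‖) * ‖e‖)
      ≤ inner ℝ (F ξ₁ - F ξ₂) (σ • e) := by
  have hdir : ∀ (ξ : Plane) {g : Plane} {d : ℝ}, c * (‖g‖ * ‖e‖) ≤ inner ℝ g e → σ * d = |d| →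
      (lam * c - C) * (|d| * ‖g‖ * ‖e‖) ≤ inner ℝ (fderiv ℝ F ξ (d • g)) (σ • e) := by
    intro ξ g d hg hd
    have h0 : 0 ≤ inner ℝ g e := le_trans (by positivity) hg
    have h1 := inner_fderiv_radial_lower hF hFh hlow hdiff hder ξ h0
    have e1 : inner ℝ (fderiv ℝ F ξ (d • g)) (σ • e) = |d| * inner ℝ (fderiv ℝ F ξ g) e := by
      rw [map_smul, real_inner_smul_left, real_inner_smul_right, ← hd]; ring
    rw [e1]
    have h2 := mul_le_mul_of_nonneg_left h1 (abs_nonneg d)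
    have h3 := mul_le_mul_of_nonneg_left hg (mul_nonneg hlam (abs_nonneg d))
    nlinarith
  have hline : ∀ t : ℝ, HasDerivAt (fun t : ℝ => ξ₂ + t • (ξ₁ - ξ₂)) (ξ₁ - ξ₂) t := fun t => by
    simpa using ((hasDerivAt_id t).smul_const (ξ₁ - ξ₂)).const_add ξ₂
  have hG : ∀ t : ℝ, HasDerivAt (fun t : ℝ => inner ℝ (F (ξ₂ + t • (ξ₁ - ξ₂))) (σ • e))
      (inner ℝ (fderiv ℝ F (ξ₂ + t • (ξ₁ - ξ₂)) (ξ₁ - ξ₂)) (σ • e)) t := fun t => by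
    have h1 := (hF.differentiable (by simp) (ξ₂ + t • (ξ₁ - ξ₂))).hasFDerivAt.comp_hasDerivAt t
      (hline t)
    simpa using h1.inner ℝ (hasDerivAt_const t (σ • e))
  -- Mean value theorem along the segment from `ξ₂` to `ξ₁`; the increment then splits into its `gi`
  -- and `gj` parts, each bounded by `hdir`.
  obtain ⟨t, -, ht⟩ := exists_hasDerivAt_eq_slope _ _ (zero_lt_one (α := ℝ))
    (fun t _ => (hG t).continuousAt.continuousWithinAt) (fun t _ => hG t)
  simp only [one_smul, zero_smul, add_zero, sub_zero, div_one, add_sub_cancel] at ht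
  rw [inner_sub_left, ← ht]
  conv_rhs => rw [hξ, map_add, inner_add_left]
  have := hdir (ξ₂ + t • (ξ₁ - ξ₂)) hi hdi
  have := hdir (ξ₂ + t • (ξ₁ - ξ₂)) hj hdj
  rw [hξ] at *
  linarith

/-! ### Lower order terms and their absorption -/

lemma abs_sub_le_of_abs_deriv_le {φ : ℝ → ℝ} {K : ℝ}
    (h : ∀ t, DifferentiableAt ℝ φ t ∧ |deriv φ t| ≤ K) (s t : ℝ) :
    |φ s - φ t| ≤ K * |s - t| := by
  simpa [Real.norm_eq_abs] using convex_univ.norm_image_sub_le_of_norm_deriv_le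
    (fun x _ => (h x).1) (fun x _ => (h x).2) (mem_univ t) (mem_univ s)

/-- Splitting the difference of two fluxes into its variation in `ξ` and in `η`. -/
lemma inner_flux_sub_lower {A : Plane → ℝ → Plane → ℝ} {x : Plane} {K m : ℝ} {η₁ η₂ : ℝ}
    {ξ₁ ξ₂ ξ ζ : Plane}
    (hA : ∀ (η : ℝ) (ξ : Plane), DifferentiableAt ℝ (fun t => A x t ξ) η ∧
      |deriv (fun t => A x t ξ) η| ≤ K)
    (hm : ∀ η, m ≤ inner ℝ (flux A x η ξ₁ - flux A x η ξ₂) ζ) (hξ : ξ = ξ₁ ∨ ξ = ξ₂) :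
    m - K * |η₁ - η₂| * (‖ξ‖ * ‖ζ‖) ≤ inner ℝ (flux A x η₁ ξ₁ - flux A x η₂ ξ₂) ζ := by
  have h1 : |(A x η₁ ξ - A x η₂ ξ) * inner ℝ ξ ζ| ≤ K * |η₁ - η₂| * (‖ξ‖ * ‖ζ‖) := by
    rw [abs_mul]
    have h2 := abs_sub_le_of_abs_deriv_le (fun η => hA η ξ) η₁ η₂
    exact mul_le_mul h2 (abs_real_inner_le_norm ξ ζ) (abs_nonneg _) ((abs_nonneg _).trans h2)
  have h3 := (abs_le.1 h1).1
  simp only [flux, inner_sub_left, real_inner_smul_left] at hm ⊢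
  -- The intermediate flux can be taken at `(η₂, ξ₁)` or at `(η₁, ξ₂)`. This choice decides whose
  -- gradient appears in the error, which is why the mesh condition for either function suffices.
  rcases hξ with rfl | rfl
  · have := hm η₂; linarith
  · have := hm η₁; linarith

/-- Where `u₁ - u₂` changes sign, monotonicity of `β` gives no sign to this term, so its Lipschitz
bound is used instead. -/
lemma sub_mul_lower_of_deriv_mem {β : ℝ → ℝ} {B : ℝ} (hβ : Differentiable ℝ β)
    (h : ∀ η, 0 ≤ deriv β η ∧ deriv β η ≤ B) {s t v : ℝ} (hv0 : 0 ≤ v) (hv1 : v ≤ 1) :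
    -(B * |s - t|) ≤ β s * v - β t * v := by
  have h1 := abs_sub_le_of_abs_deriv_le
    (fun η => ⟨hβ η, abs_le.2 ⟨by linarith [(h η).1, (h η).2], (h η).2⟩⟩) s t
  have h2 : |(β s - β t) * v| ≤ B * |s - t| := by
    rw [abs_mul, abs_of_nonneg hv0]
    exact (mul_le_of_le_one_right (abs_nonneg _) hv1).trans h1
  have := (abs_le.1 h2).1
  linarith

/-- The mesh condition absorbs the lower order terms of a triangle where the sign changes. -/
lemma pos_of_mesh_condition {P q p K B δ r area s S di dj ni nj n w x : ℝ}
    (hK : 0 ≤ K) (hB : 0 ≤ B) (hδ : 0 ≤ δ) (hr : 0 < r) (harea : 0 ≤ area) (hs : 0 ≤ s)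
    (hdi : 0 ≤ di) (hdj : 0 ≤ dj) (hS : S = di + dj) (hSpos : 0 < S)
    (hni : 0 < ni) (hnj : 0 < nj) (hn : 0 < n)
    (hrij : r * ni ≤ nj) (hrji : r * nj ≤ ni)
    (hai : 1 ≤ 2 * area * s * (ni * n)) (haj : 1 ≤ 2 * area * s * (nj * n))
    (hw0 : 0 ≤ w) (hw : w ≤ S) (hx : x ≤ δ * (ni + nj)) (hp : p ≤ P)
    (hM : 0 < p - δ * (7 * K * (1 + r⁻¹) / 6) - 7 * B * area * s / 3)
    (hq : q = P * ((di * ni + dj * nj) * n) - K * w * (x * n)) :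
    0 < q - B * w := by
  -- `m` is the smaller of `ni` and `nj`; the ratio bounds control the larger one by `m / r`.
  obtain ⟨m, hm0, hmi, hmj, hsum, ha⟩ : ∃ m, 0 < m ∧ m ≤ ni ∧ m ≤ nj ∧
      ni + nj ≤ m * (1 + r⁻¹) ∧ 1 ≤ 2 * area * s * (m * n) := by
    rcases le_total ni nj with h | h
    · refine ⟨ni, hni, le_rfl, h, ?_, hai⟩
      have : nj ≤ ni * r⁻¹ := by rw [← div_eq_mul_inv, le_div_iff₀ hr]; linarith
      linarith
    · refine ⟨nj, hnj, h, le_rfl, ?_, haj⟩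
      have : ni ≤ nj * r⁻¹ := by rw [← div_eq_mul_inv, le_div_iff₀ hr]; linarith
      linarith
  have hri : 0 < 1 + r⁻¹ := by positivity
  have t1 : 0 ≤ K * δ * (1 + r⁻¹) := by positivity
  have t2 : 0 ≤ B * area * s := by positivity
  have hP : 0 ≤ P := by linarith
  have e1 : P * (S * m * n) ≤ P * ((di * ni + dj * nj) * n) := by
    rw [hS, add_mul]; gcongr
  have e2 : K * w * (x * n) ≤ K * S * (δ * (m * (1 + r⁻¹)) * n) := by
    calc K * w * (x * n) ≤ K * w * (δ * (m * (1 + r⁻¹)) * n) := by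
          gcongr
          exact hx.trans (by gcongr)
      _ ≤ _ := by gcongr
  have e3 : B * w ≤ B * S * (2 * area * s * (m * n)) :=
    calc B * w ≤ B * S * 1 := by rw [mul_one]; gcongr
      _ ≤ _ := by gcongr
  -- The estimates need only the constants 1 and 2 here; the 7/6 and 7/3 of the mesh condition are
  -- larger.
  have e4 : 0 < (S * m * n) * (P - K * δ * (1 + r⁻¹) - 2 * (B * area * s)) := by
    apply mul_pos (by positivity); linarith
  rw [hq]
  linarith

/-! ### Piecewise affine functions on the mesh -/

lemma AffineMap.le_of_vertices {T : Affine.Triangle ℝ Plane} {L : Plane →ᵃ[ℝ] ℝ} {M : ℝ}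
    (h : ∀ i, L (T.points i) ≤ M) {x : Plane} (hx : x ∈ T.closedInterior) : L x ≤ M := by
  rw [closedInterior_eq_hull] at hx
  have hc : Convex ℝ (L ⁻¹' Iic M) := (convex_Iic M).affine_preimage L
  exact convexHull_min (by rintro _ ⟨i, rfl⟩; exact h i) hc hx

lemma AffineMap.ge_of_vertices {T : Affine.Triangle ℝ Plane} {L : Plane →ᵃ[ℝ] ℝ} {M : ℝ}
    (h : ∀ i, M ≤ L (T.points i)) {x : Plane} (hx : x ∈ T.closedInterior) : M ≤ L x := by
  rw [closedInterior_eq_hull] at hx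
  have hc : Convex ℝ (L ⁻¹' Ici M) := (convex_Ici M).affine_preimage L
  exact convexHull_min (by rintro _ ⟨i, rfl⟩; exact h i) hc hx

lemma AffineMap.eqOn_convexHull {L L' : Plane →ᵃ[ℝ] ℝ} {s : Set Plane} (h : EqOn L L' s) :
    EqOn L L' (convexHull ℝ s) := by
  intro x hx
  have hc : Convex ℝ ((L - L') ⁻¹' {0}) := (convex_singleton (0 : ℝ)).affine_preimage (L - L')
  have := convexHull_min (t := (L - L') ⁻¹' {0})
    (fun y hy => by simp [h hy]) hc hx
  simpa [sub_eq_zero] using this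

lemma exists_affine_of_vertices (T : Affine.Triangle ℝ Plane) (c : Plane → ℝ) :
    ∃ L : Plane →ᵃ[ℝ] ℝ, ∀ i, L (T.points i) = c (T.points i) := by
  let b : AffineBasis (Fin 3) ℝ Plane := ⟨T.points, T.independent,
    T.independent.affineSpan_eq_top_iff_card_eq_finrank_add_one.2 (by simp)⟩
  have hb : ∀ i, b i = T.points i := fun _ => rfl
  refine ⟨∑ j, c (T.points j) • b.coord j, fun i => ?_⟩
  rw [← hb i]
  have : ∀ s : Finset (Fin 3), (∑ j ∈ s, c (T.points j) • b.coord j) (b i)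
      = ∑ j ∈ s, c (T.points j) * b.coord j (b i) := by
    intro s
    induction s using Finset.induction_on with
    | empty => simp
    | insert j s hj ih => rw [Finset.sum_insert hj, Finset.sum_insert hj, ← ih]; simp
  rw [this, Finset.sum_eq_single i]
  · rw [b.coord_apply_eq, mul_one, hb]
  · intro j _ hj; simp [hj]
  · simp

/-- Interpolation of nodal values on a conforming mesh. -/
lemma exists_interpolant {𝒯 : Finset (Affine.Triangle ℝ Plane)}
    (hconf : ∀ T ∈ 𝒯, ∀ T' ∈ 𝒯,
      T.closedInterior ∩ T'.closedInterior = convexHull ℝ (range T.points ∩ range T'.points))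
    (c : Plane → ℝ) :
    ∃ v : Plane → ℝ, (∀ T ∈ 𝒯, ∃ L : Plane →ᵃ[ℝ] ℝ, ∀ x ∈ T.closedInterior, v x = L x) ∧
      ∀ T ∈ 𝒯, ∀ i, v (T.points i) = c (T.points i) := by
  classical
  choose L hL using fun T => exists_affine_of_vertices T c
  -- The triangle containing `x` is chosen arbitrarily. Conformity makes the value independent of
  -- the choice: two affine pieces agree at the common vertices, hence on their convex hull.
  let v : Plane → ℝ := fun x =>
    if h : ∃ T ∈ 𝒯, x ∈ T.closedInterior then L h.choose x else 0
  have hv : ∀ T ∈ 𝒯, ∀ x ∈ T.closedInterior, v x = L T x := by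
    intro T hT x hx
    have h : ∃ T ∈ 𝒯, x ∈ T.closedInterior := ⟨T, hT, hx⟩
    have hx' : x ∈ convexHull ℝ (range h.choose.points ∩ range T.points) := by
      rw [← hconf _ h.choose_spec.1 T hT]; exact ⟨h.choose_spec.2, hx⟩
    simp only [v, dif_pos h]
    refine AffineMap.eqOn_convexHull ?_ hx'
    rintro _ ⟨⟨i, rfl⟩, j, hj⟩
    rw [hL, ← hj, hL]
  exact ⟨v, fun T hT => ⟨L T, hv T hT⟩, fun T hT i => by
    rw [hv T hT _ (T.point_mem_closedInterior i), hL]⟩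

/-- Together with `exists_nodal_gradients`, this expresses every gradient on a triangle by
differences of vertex values. -/
lemma inner_gradient_of_affine {T : Affine.Triangle ℝ Plane} {φ : Plane → ℝ}
    {L : Plane →ᵃ[ℝ] ℝ} (h : ∀ x ∈ T.closedInterior, φ x = L x) {x : Plane}
    (hx : x ∈ interior T.closedInterior) (i k : Fin 3) :
    inner ℝ (gradient φ x) (T.points i - T.points k) = φ (T.points i) - φ (T.points k) := by
  have hL : HasFDerivAt (fun y => L y) L.linear.toContinuousLinearMap x := by
    have e : (fun y => L y) = fun y => L.linear.toContinuousLinearMap y + L 0 := by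
      ext y; have := L.linearMap_vsub y 0; simp at this; simp [this]
    rw [e]
    exact (ContinuousLinearMap.hasFDerivAt _).add_const _
  have hφ : HasFDerivAt φ L.linear.toContinuousLinearMap x :=
    hL.congr_of_eventuallyEq (Filter.eventuallyEq_of_mem (mem_interior_iff_mem_nhds.1 hx) h)
  rw [gradient, hφ.fderiv, InnerProductSpace.toDual_symm_apply,
    h _ (T.point_mem_closedInterior i), h _ (T.point_mem_closedInterior k)]
  exact L.linearMap_vsub _ _

lemma eq_zero_of_inner_edges (T : Affine.Triangle ℝ Plane) {ξ : Plane}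
    (h : ∀ i k, inner ℝ ξ (T.points i - T.points k) = 0) : ξ = 0 := by
  obtain ⟨gi, gj, hrep, -⟩ := exists_nodal_gradients T 0
  have := hrep ξ
  rwa [h, h, zero_smul, zero_smul, add_zero] at this

lemma interior_closedInterior_nonempty (T : Affine.Triangle ℝ Plane) :
    (interior T.closedInterior).Nonempty := by
  rw [closedInterior_eq_hull, interior_convexHull_nonempty_iff_affineSpan_eq_top]
  exact T.independent.affineSpan_eq_top_iff_card_eq_finrank_add_one.2 (by simp)

/-- With three vertices and two signs, a mixed pattern always isolates a single vertex; this yields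
the three cases of the sign analysis. -/
lemma forall_or_lone (P : Fin 3 → Prop) : (∀ i, P i) ∨ (∀ i, ¬P i) ∨
    ∃ k, (P k ∧ ¬P (k + 1) ∧ ¬P (k + 2)) ∨ (¬P k ∧ P (k + 1) ∧ P (k + 2)) := by
  simp only [Fin.forall_fin_succ, Fin.exists_fin_succ, IsEmpty.forall_iff, IsEmpty.exists_iff]
  simp
  tauto

/-! ### Pointwise sign of the difference of the integrands -/

/-- What the assumptions on the coefficients say at almost every point `x`. -/
structure RegularAt (A : Plane → ℝ → Plane → ℝ) (b : Plane → ℝ → ℝ) (lam C K B : ℝ)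
    (x : Plane) : Prop where
  contDiff : ∀ η, ContDiff ℝ 1 (flux A x η)
  radial : ∀ η, ∃ h : ℝ → ℝ, (∀ ξ, flux A x η ξ = h ‖ξ‖ • ξ) ∧ (∀ s, 0 ≤ s → lam ≤ h s) ∧
    (∀ s, 0 < s → DifferentiableAt ℝ h s) ∧ ∀ s, 0 < s → s * |deriv h s| ≤ C
  A_deriv : ∀ (η : ℝ) (ξ : Plane),
    DifferentiableAt ℝ (fun t => A x t ξ) η ∧ |deriv (fun t => A x t ξ) η| ≤ K
  b_diff : Differentiable ℝ (b x)
  b_deriv : ∀ η : ℝ, 0 ≤ deriv (b x) η ∧ deriv (b x) η ≤ B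

section

variable {Ω : Set Plane} {A : Plane → ℝ → Plane → ℝ} {b : Plane → ℝ → ℝ}
  {A₀ A₁ : Plane → ℝ → ℝ} {A₂ : Plane → ℝ} {f g : ℝ → ℝ}
  {γa Kη Bη lam₀ Λ₁ Λ₂ Cf Cg : ℝ}

/-- For fixed `x` and `η` the flux is radial in `ξ`, with profile `h = A₀ + A₁ f + A₂ g`.
Nonnegativity of the last two summands gives `h ≥ lam₀`, and the two derivative bounds add up. -/
lemma ae_regularAt (hΩ : MeasurableSet Ω) (hcoeff : CoefficientAssumptions Ω A b γa Kη Bη)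
    (hform : DiffusionForm Ω A A₀ A₁ A₂ f g lam₀ Λ₁ Λ₂ Cf Cg) :
    ∀ᵐ x ∂volume.restrict Ω, RegularAt A b lam₀ (Λ₁ * Cf + Λ₂ * Cg) Kη Bη x := by
  filter_upwards [hcoeff.flux_contDiff, hcoeff.b_contDiff, hcoeff.A_deriv, hcoeff.b_deriv,
    hform.A₀_bound, hform.A₁_bound, hform.A₂_bound, ae_restrict_mem hΩ]
    with x h1 h2 h3 h4 h5 h6 h7 h8
  refine ⟨fun η => h1.comp (contDiff_const.prodMk contDiff_id), fun η => ?_, h3,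
    h2.differentiable (by simp), h4⟩
  refine ⟨fun s => A₀ x η + A₁ x η * f s + A₂ x * g s, fun ξ => ?_, fun s hs => ?_,
    fun s hs => ?_, fun s hs => ?_⟩
  · simp only [flux, hform.decomp x h8]
  · have := mul_nonneg (h6 η).1 (hform.f_nonneg s hs)
    have := mul_nonneg h7.1 (hform.g_nonneg s hs)
    have := h5 η
    linarith
  · exact (((hform.f_differentiable s hs).const_mul _).const_add _).add
      ((hform.g_differentiable s hs).const_mul _)
  · have hd : HasDerivAt (fun s => A₀ x η + A₁ x η * f s + A₂ x * g s)
        (A₁ x η * deriv f s + A₂ x * deriv g s) s :=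
      (((hform.f_differentiable s hs).hasDerivAt.const_mul _).const_add _).add
        ((hform.g_differentiable s hs).hasDerivAt.const_mul _)
    rw [hd.deriv]
    calc s * |A₁ x η * deriv f s + A₂ x * deriv g s|
        ≤ s * (|A₁ x η * deriv f s| + |A₂ x * deriv g s|) := by gcongr; exact abs_add_le _ _
      _ = A₁ x η * (s * |deriv f s|) + A₂ x * (s * |deriv g s|) := by
        rw [abs_mul, abs_mul, abs_of_nonneg (h6 η).1, abs_of_nonneg h7.1]; ring
      _ ≤ Λ₁ * Cf + Λ₂ * Cg := by
        have hf := hform.f_deriv s hs.le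
        have hg := hform.g_deriv s hs.le
        exact add_le_add
          (mul_le_mul (h6 η).2 hf (by positivity) hform.Λ₁_nonneg)
          (mul_le_mul h7.2 hg (by positivity) hform.Λ₂_nonneg)

lemma weakIntegrand_sub (u₁ u₂ v : Plane → ℝ) (x : Plane) :
    weakIntegrand A b u₁ v x - weakIntegrand A b u₂ v x =
      inner ℝ (flux A x (u₁ x) (gradient u₁ x) - flux A x (u₂ x) (gradient u₂ x)) (gradient v x)
        + (b x (u₁ x) * v x - b x (u₂ x) * v x) := by
  simp only [weakIntegrand, inner_sub_left]; ring

/-- On a triangle where the test function does not distinguish the vertices, the difference of the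
integrands is nonnegative at points where the test function vanishes or `u₂ ≤ u₁`. -/
lemma weakIntegrand_sub_nonneg_of_const {C : ℝ} {T : Affine.Triangle ℝ Plane} {x : Plane}
    (hx : x ∈ interior T.closedInterior) (hreg : RegularAt A b lam₀ C Kη Bη x)
    {u₁ u₂ v : Plane → ℝ} {L : Plane →ᵃ[ℝ] ℝ} (hL : ∀ y ∈ T.closedInterior, v y = L y)
    (hconst : ∀ i j, v (T.points i) = v (T.points j))
    (hsign : v x = 0 ∨ (0 ≤ v x ∧ u₂ x ≤ u₁ x)) :
    0 ≤ weakIntegrand A b u₁ v x - weakIntegrand A b u₂ v x := by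
  have hg : gradient v x = 0 := eq_zero_of_inner_edges T fun i k => by
    rw [inner_gradient_of_affine hL hx, hconst i k, sub_self]
  rw [weakIntegrand_sub, hg, inner_zero_right, zero_add, ← sub_mul]
  rcases hsign with h | ⟨h0, h⟩
  · rw [h, mul_zero]
  · exact mul_nonneg (sub_nonneg.2 (monotone_of_deriv_nonneg hreg.b_diff
      (fun η => (hreg.b_deriv η).1) h)) h0

/-- On a triangle where `u₁ - u₂` changes its sign, with the vertex `k` on one side and the other
two vertices on the other side, the difference of the integrands is positive. -/
lemma weakIntegrand_sub_pos_of_lone (hlam : 0 < lam₀) (hK : 0 ≤ Kη) (hB : 0 ≤ Bη)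
    (hC : 0 ≤ Λ₁ * Cf + Λ₂ * Cg)
    {T : Affine.Triangle ℝ Plane} {x : Plane}
    (hx : x ∈ interior T.closedInterior)
    (hreg : RegularAt A b lam₀ (Λ₁ * Cf + Λ₂ * Cg) Kη Bη x)
    {u₁ u₂ u v : Plane → ℝ} (hu : u = u₁ ∨ u = u₂) {L₁ L₂ L : Plane →ᵃ[ℝ] ℝ}
    (hL₁ : ∀ y ∈ T.closedInterior, u₁ y = L₁ y) (hL₂ : ∀ y ∈ T.closedInterior, u₂ y = L₂ y)
    (hL : ∀ y ∈ T.closedInterior, v y = L y)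
    (hM : 0 < pStar lam₀ Λ₁ Λ₂ Cf Cg γa T
      - vertexVariation T u * (7 * Kη * (1 + (sinRatio T)⁻¹) / 6)
      - 7 * Bη * area T * sinMax T / 3)
    {k : Fin 3} {σ di dj : ℝ} (hσ : |σ| = 1)
    (hvi : v (T.points (k + 1)) - v (T.points k) = σ)
    (hvj : v (T.points (k + 2)) - v (T.points k) = σ)
    (hdi : u₁ (T.points (k + 1)) - u₂ (T.points (k + 1))
      - (u₁ (T.points k) - u₂ (T.points k)) = di)
    (hdj : u₁ (T.points (k + 2)) - u₂ (T.points (k + 2))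
      - (u₁ (T.points k) - u₂ (T.points k)) = dj)
    (hσi : σ * di = |di|) (hσj : σ * dj = |dj|) (hpos : 0 < |di| + |dj|)
    (hw : |u₁ x - u₂ x| ≤ |di| + |dj|) (hv0 : 0 ≤ v x) (hv1 : v x ≤ 1) :
    0 < weakIntegrand A b u₁ v x - weakIntegrand A b u₂ v x := by
  obtain ⟨gi, gj, hrep, ⟨hni, hnj, hn⟩, ⟨hci, hcj⟩, ⟨hrij, hrji⟩, hai, haj⟩ :=
    exists_nodal_gradients T k
  have hδ : 0 ≤ vertexVariation T u := (abs_nonneg _).trans (le_vertexVariation T u 0 0)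
  have hr := sinRatio_pos T
  have hs : 0 ≤ sinMax T := (sin_angle_pos T 0).le.trans (le_sinMax T 0)
  have harea : 0 ≤ area T := measureReal_nonneg
  have hp : pStar lam₀ Λ₁ Λ₂ Cf Cg γa T ≤ lam₀ * cosMin T - (Λ₁ * Cf + Λ₂ * Cg) :=
    (min_le_left _ _).trans (by linarith)
  have t1 : 0 ≤ vertexVariation T u * (7 * Kη * (1 + (sinRatio T)⁻¹) / 6) := by positivity
  have t2 : 0 ≤ 7 * Bη * area T * sinMax T / 3 := by positivity
  -- Otherwise the first entry of the minimum `pStar` would be negative, contradicting the mesh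
  -- condition.
  have hcos : 0 ≤ cosMin T := by
    by_contra h
    have := mul_neg_of_pos_of_neg hlam (not_le.1 h)
    linarith
  have hgv : gradient v x = σ • (gi + gj) := by
    rw [hrep (gradient v x), inner_gradient_of_affine hL hx, inner_gradient_of_affine hL hx,
      hvi, hvj, smul_add]
  have hgw : gradient u₁ x - gradient u₂ x = di • gi + dj • gj := by
    rw [hrep (gradient u₁ x - gradient u₂ x), inner_sub_left, inner_sub_left,
      inner_gradient_of_affine hL₁ hx, inner_gradient_of_affine hL₁ hx,
      inner_gradient_of_affine hL₂ hx, inner_gradient_of_affine hL₂ hx, ← hdi, ← hdj]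
    congr 2 <;> ring
  have hLu : ∃ L' : Plane →ᵃ[ℝ] ℝ, ∀ y ∈ T.closedInterior, u y = L' y := by
    rcases hu with rfl | rfl
    exacts [⟨L₁, hL₁⟩, ⟨L₂, hL₂⟩]
  obtain ⟨L', hL'⟩ := hLu
  have hgu : ‖gradient u x‖ ≤ vertexVariation T u * (‖gi‖ + ‖gj‖) := by
    rw [hrep (gradient u x), inner_gradient_of_affine hL' hx, inner_gradient_of_affine hL' hx]
    refine (norm_add_le _ _).trans ?_
    rw [norm_smul, norm_smul, Real.norm_eq_abs, Real.norm_eq_abs, mul_add]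
    gcongr <;> exact le_vertexVariation T u _ _
  have hm : ∀ η, (lam₀ * cosMin T - (Λ₁ * Cf + Λ₂ * Cg)) *
      ((|di| * ‖gi‖ + |dj| * ‖gj‖) * ‖gi + gj‖) ≤
        inner ℝ (flux A x η (gradient u₁ x) - flux A x η (gradient u₂ x)) (gradient v x) := by
    intro η
    obtain ⟨h, h1, h2, h3, h4⟩ := hreg.radial η
    rw [hgv]
    exact inner_radial_sub_lower hlam.le hcos (hreg.contDiff η) h1 h2 h3 h4 hci hcj hσi hσj hgw
  have hflux := inner_flux_sub_lower (η₁ := u₁ x) (η₂ := u₂ x) (ξ := gradient u x) hreg.A_deriv hm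
    (by rcases hu with rfl | rfl; exacts [Or.inl rfl, Or.inr rfl])
  have hng : ‖gradient v x‖ = ‖gi + gj‖ := by
    rw [hgv, norm_smul, Real.norm_eq_abs, hσ, one_mul]
  have hb := sub_mul_lower_of_deriv_mem (s := u₁ x) (t := u₂ x) hreg.b_diff hreg.b_deriv hv0 hv1
  have := pos_of_mesh_condition hK hB hδ hr harea hs (abs_nonneg di) (abs_nonneg dj) rfl hpos
    hni hnj hn hrij hrji hai haj (abs_nonneg (u₁ x - u₂ x)) hw hgu hp hM rfl
  rw [weakIntegrand_sub]
  rw [hng] at hflux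
  linarith

end

section

variable {Ω : Set Plane} {𝒯 : Finset (Affine.Triangle ℝ Plane)} {ΓD : Set Plane}
  {A : Plane → ℝ → Plane → ℝ} {b : Plane → ℝ → ℝ}
  {A₀ A₁ : Plane → ℝ → ℝ} {A₂ : Plane → ℝ} {f g : ℝ → ℝ}
  {γa Kη Bη lam₀ Λ₁ Λ₂ Cf Cg : ℝ}

lemma eq_of_vertices {T : Affine.Triangle ℝ Plane} {v : Plane → ℝ} {L : Plane →ᵃ[ℝ] ℝ} {m : ℝ}
    (hL : ∀ y ∈ T.closedInterior, v y = L y) (h : ∀ i, v (T.points i) = m) {x : Plane}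
    (hx : x ∈ T.closedInterior) : v x = m := by
  have h' : ∀ i, L (T.points i) = m := fun i => by
    rw [← hL _ (T.point_mem_closedInterior i), h]
  rw [hL x hx]
  exact le_antisymm (AffineMap.le_of_vertices (fun i => (h' i).le) hx)
    (AffineMap.ge_of_vertices (fun i => (h' i).ge) hx)

/-- The difference of two functions that are affine on a triangle is bounded there by its values
at the vertices. -/
lemma sub_mem_Icc_of_vertices {T : Affine.Triangle ℝ Plane} {u₁ u₂ : Plane → ℝ}
    {L₁ L₂ : Plane →ᵃ[ℝ] ℝ} (hL₁ : ∀ y ∈ T.closedInterior, u₁ y = L₁ y)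
    (hL₂ : ∀ y ∈ T.closedInterior, u₂ y = L₂ y) {m M : ℝ}
    (h : ∀ i, u₁ (T.points i) - u₂ (T.points i) ∈ Icc m M) {x : Plane}
    (hx : x ∈ T.closedInterior) : u₁ x - u₂ x ∈ Icc m M := by
  have h' : ∀ i, (L₁ - L₂) (T.points i) ∈ Icc m M := fun i => by
    have := h i
    rwa [hL₁ _ (T.point_mem_closedInterior i), hL₂ _ (T.point_mem_closedInterior i)] at this
  rw [hL₁ x hx, hL₂ x hx]
  exact ⟨AffineMap.ge_of_vertices (L := L₁ - L₂) (fun i => (h' i).1) hx,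
    AffineMap.le_of_vertices (L := L₁ - L₂) (fun i => (h' i).2) hx⟩

/-- The sign of the difference of the integrands for the test function whose nodal values are one
where `u₂ < u₁` and zero elsewhere. -/
lemma weakIntegrand_sub_sign (hlam : 0 < lam₀) (hK : 0 ≤ Kη) (hB : 0 ≤ Bη)
    (hC : 0 ≤ Λ₁ * Cf + Λ₂ * Cg) {T : Affine.Triangle ℝ Plane} {x : Plane}
    (hx : x ∈ interior T.closedInterior)
    (hreg : RegularAt A b lam₀ (Λ₁ * Cf + Λ₂ * Cg) Kη Bη x)
    {u₁ u₂ u v : Plane → ℝ} (hu : u = u₁ ∨ u = u₂) {L₁ L₂ L : Plane →ᵃ[ℝ] ℝ}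
    (hL₁ : ∀ y ∈ T.closedInterior, u₁ y = L₁ y) (hL₂ : ∀ y ∈ T.closedInterior, u₂ y = L₂ y)
    (hL : ∀ y ∈ T.closedInterior, v y = L y)
    (hM : 0 < pStar lam₀ Λ₁ Λ₂ Cf Cg γa T
      - vertexVariation T u * (7 * Kη * (1 + (sinRatio T)⁻¹) / 6)
      - 7 * Bη * area T * sinMax T / 3)
    (hone : ∀ i, u₂ (T.points i) < u₁ (T.points i) → v (T.points i) = 1)
    (hzero : ∀ i, ¬u₂ (T.points i) < u₁ (T.points i) → v (T.points i) = 0) :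
    0 ≤ weakIntegrand A b u₁ v x - weakIntegrand A b u₂ v x ∧
      ((∀ i, v (T.points i) = 1) ∨ (∀ i, v (T.points i) = 0) ∨
        0 < weakIntegrand A b u₁ v x - weakIntegrand A b u₂ v x) := by
  have hxT := interior_subset hx
  rcases forall_or_lone fun i => u₂ (T.points i) < u₁ (T.points i) with h | h | ⟨k, hk⟩
  · have h1 := fun i => hone i (h i)
    refine ⟨weakIntegrand_sub_nonneg_of_const hx hreg hL (fun i j => by rw [h1, h1])
      (Or.inr ⟨by rw [eq_of_vertices hL h1 hxT]; norm_num, ?_⟩), Or.inl h1⟩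
    rw [hL₁ x hxT, hL₂ x hxT, ← sub_nonneg]
    refine AffineMap.ge_of_vertices (L := L₁ - L₂) (fun i => ?_) hxT
    have := h i
    rw [hL₁ _ (T.point_mem_closedInterior i), hL₂ _ (T.point_mem_closedInterior i)] at this
    exact (sub_pos.2 this).le
  · have h0 := fun i => hzero i (h i)
    exact ⟨weakIntegrand_sub_nonneg_of_const hx hreg hL (fun i j => by rw [h0, h0])
      (Or.inl (eq_of_vertices hL h0 hxT)), Or.inr (Or.inl h0)⟩
  · suffices 0 < weakIntegrand A b u₁ v x - weakIntegrand A b u₂ v x from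
      ⟨this.le, Or.inr (Or.inr this)⟩
    have hv01 : ∀ i, v (T.points i) ∈ Icc (0 : ℝ) 1 := fun i => by
      by_cases h : u₂ (T.points i) < u₁ (T.points i)
      · rw [hone i h]; simp
      · rw [hzero i h]; simp
    have hv0 : 0 ≤ v x := by
      rw [hL x hxT]
      exact AffineMap.ge_of_vertices (fun i => by
        rw [← hL _ (T.point_mem_closedInterior i)]; exact (hv01 i).1) hxT
    have hv1 : v x ≤ 1 := by
      rw [hL x hxT]
      exact AffineMap.le_of_vertices (fun i => by
        rw [← hL _ (T.point_mem_closedInterior i)]; exact (hv01 i).2) hxT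
    have hcases : ∀ {p : Fin 3 → Prop}, p k → p (k + 1) → p (k + 2) → ∀ i, p i := by
      intro p h0 h1 h2 i
      have : i = k ∨ i = k + 1 ∨ i = k + 2 := by clear * -; revert i k; decide
      rcases this with rfl | rfl | rfl <;> assumption
    have hbound : ∀ S : ℝ,
        |u₁ (T.points k) - u₂ (T.points k)| ≤ S →
        |u₁ (T.points (k + 1)) - u₂ (T.points (k + 1))| ≤ S →
        |u₁ (T.points (k + 2)) - u₂ (T.points (k + 2))| ≤ S → |u₁ x - u₂ x| ≤ S := by
      intro S h0 h1 h2
      have := sub_mem_Icc_of_vertices hL₁ hL₂ (m := -S) (M := S)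
        (hcases (p := fun i => u₁ (T.points i) - u₂ (T.points i) ∈ Icc (-S) S)
          (abs_le.1 h0) (abs_le.1 h1) (abs_le.1 h2)) hxT
      exact abs_le.2 this
    set di := u₁ (T.points (k + 1)) - u₂ (T.points (k + 1))
      - (u₁ (T.points k) - u₂ (T.points k)) with hdi
    set dj := u₁ (T.points (k + 2)) - u₂ (T.points (k + 2))
      - (u₁ (T.points k) - u₂ (T.points k)) with hdj
    -- One side of the sign change is strict, so `di` and `dj` are nonzero with the sign of `σ`. As
    -- `u₁ - u₂` has opposite signs at `k` and at the other vertices, each vertex value is bounded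
    -- by `|di| + |dj|`.
    rcases hk with ⟨h0, h1, h2⟩ | ⟨h0, h1, h2⟩
    · have e0 := hone _ h0
      have e1 := hzero _ h1
      have e2 := hzero _ h2
      rw [not_lt] at h1 h2
      have ai : |di| = -di := abs_of_neg (by linarith)
      have aj : |dj| = -dj := abs_of_neg (by linarith)
      refine weakIntegrand_sub_pos_of_lone hlam hK hB hC hx hreg hu hL₁ hL₂ hL hM
        (k := k) (σ := -1) (di := di) (dj := dj) (by simp) (by rw [e0, e1]; norm_num)
        (by rw [e0, e2]; norm_num) rfl rfl (by rw [ai]; ring) (by rw [aj]; ring)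
        (by rw [ai, aj]; linarith) ?_ hv0 hv1
      rw [ai, aj]
      refine hbound _ ?_ ?_ ?_ <;> rw [abs_le] <;> constructor <;> linarith
    · have e0 := hzero _ h0
      have e1 := hone _ h1
      have e2 := hone _ h2
      rw [not_lt] at h0
      have ai : |di| = di := abs_of_pos (by linarith)
      have aj : |dj| = dj := abs_of_pos (by linarith)
      refine weakIntegrand_sub_pos_of_lone hlam hK hB hC hx hreg hu hL₁ hL₂ hL hM
        (k := k) (σ := 1) (di := di) (dj := dj) (by simp) (by rw [e0, e1]; norm_num)
        (by rw [e0, e2]; norm_num) rfl rfl (by rw [ai]; ring) (by rw [aj]; ring)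
        (by rw [ai, aj]; linarith) ?_ hv0 hv1
      rw [ai, aj]
      refine hbound _ ?_ ?_ ?_ <;> rw [abs_le] <;> constructor <;> linarith

/-! ### From single triangles to the whole domain -/

lemma IsTriangulation.exists_mem (h𝒯 : IsTriangulation Ω 𝒯) {x : Plane} (hx : x ∈ closure Ω) :
    ∃ T ∈ 𝒯, x ∈ T.closedInterior := by
  rw [h𝒯.cover, mem_iUnion₂] at hx
  simpa using hx

/-- Almost every point of the domain lies in the interior of a triangle. -/
lemma ae_mem_interior (h𝒯 : IsTriangulation Ω 𝒯) :
    ∀ᵐ x ∂volume.restrict Ω, ∃ T ∈ 𝒯, x ∈ interior T.closedInterior := by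
  have h : ∀ᵐ x ∂volume.restrict Ω, ∀ T ∈ 𝒯, x ∉ frontier T.closedInterior := by
    rw [Filter.eventually_all_finset]
    intro T _
    -- The frontier of a convex set is a null set.
    exact ae_restrict_of_ae (measure_eq_zero_iff_ae_notMem.1
      ((convex_closedInterior T).addHaar_frontier volume))
  filter_upwards [h, ae_restrict_mem h𝒯.isOpen.measurableSet] with x hx hxΩ
  obtain ⟨T, hT, hxT⟩ := h𝒯.exists_mem (subset_closure hxΩ)
  refine ⟨T, hT, ?_⟩
  by_contra hi
  exact hx T hT ⟨subset_closure hxT, hi⟩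

/-- On a connected triangulated domain, a function that is constantly one or constantly zero on
each triangle and vanishes somewhere vanishes everywhere. -/
lemma forall_zero_of_zero_or_one (h𝒯 : IsTriangulation Ω 𝒯) {v : Plane → ℝ}
    (h : ∀ T ∈ 𝒯, (∀ x ∈ T.closedInterior, v x = 1) ∨ ∀ x ∈ T.closedInterior, v x = 0)
    {p : Plane} (hp : p ∈ closure Ω) (hvp : v p = 0) : ∀ x ∈ closure Ω, v x = 0 := by
  have hcov : ∀ x ∈ closure Ω, ∃ T ∈ 𝒯, x ∈ T.closedInterior := fun _ => h𝒯.exists_mem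
  have hclosed : ∀ m : ℝ, IsClosed
      (⋃ T ∈ {T ∈ (𝒯 : Set (Affine.Triangle ℝ Plane)) | ∀ x ∈ T.closedInterior, v x = m},
        T.closedInterior) := fun m =>
    (𝒯.finite_toSet.subset fun _ h => h.1).isClosed_biUnion fun T _ => T.isClosed_closedInterior
  intro x hx
  by_contra hvx
  obtain ⟨T, hT, hxT⟩ := hcov x hx
  have hT1 := (h T hT).resolve_right fun h0 => hvx (h0 x hxT)
  obtain ⟨T', hT', hpT'⟩ := hcov p hp
  have hT0 := (h T' hT').resolve_left fun h1 => by
    have := h1 p hpT'; rw [hvp] at this; norm_num at this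
  -- The triangles with value 0 and those with value 1 form two closed sets covering the connected
  -- set `closure Ω`. If both met it they would share a point, where `v` would be both 0 and 1.
  obtain ⟨y, -, hy0, hy1⟩ := isPreconnected_closed_iff.1 h𝒯.isConnected.isPreconnected.closure
    _ _ (hclosed 0) (hclosed 1)
    (fun y hy => by
      obtain ⟨S, hS, hyS⟩ := hcov y hy
      rcases h S hS with h1 | h0
      · exact Or.inr (mem_biUnion ⟨hS, h1⟩ hyS)
      · exact Or.inl (mem_biUnion ⟨hS, h0⟩ hyS))
    ⟨p, hp, mem_biUnion ⟨hT', hT0⟩ hpT'⟩ ⟨x, hx, mem_biUnion ⟨hT, hT1⟩ hxT⟩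
  obtain ⟨S, hS, hyS⟩ := mem_iUnion₂.1 hy0
  obtain ⟨S', hS', hyS'⟩ := mem_iUnion₂.1 hy1
  have := hS.2 y hyS
  rw [hS'.2 y hyS'] at this
  norm_num at this

/-- The comparison principle, with the mesh condition for either of the two functions. -/
theorem le_of_meshCondition {ψ : Plane → ℝ} (h𝒯 : IsTriangulation Ω 𝒯)
    (hΓD : IsDirichletPart Ω 𝒯 ΓD)
    (hcoeff : CoefficientAssumptions Ω A b γa Kη Bη)
    (hform : DiffusionForm Ω A A₀ A₁ A₂ f g lam₀ Λ₁ Λ₂ Cf Cg)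
    {u₁ u₂ u : Plane → ℝ} (h₁ : IsSubsolution Ω 𝒯 ΓD A b ψ u₁)
    (h₂ : IsSupersolution Ω 𝒯 ΓD A b ψ u₂) (hu : u = u₁ ∨ u = u₂)
    (hM : MeshCondition 𝒯 lam₀ Λ₁ Λ₂ Cf Cg γa Kη Bη u) : ∀ x ∈ Ω, u₁ x ≤ u₂ x := by
  classical
  -- The derivative bounds at `s = 0` say that `Cf` and `Cg` are nonnegative.
  have hC : 0 ≤ Λ₁ * Cf + Λ₂ * Cg := by
    have h1 := hform.f_deriv 0 le_rfl
    have h2 := hform.g_deriv 0 le_rfl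
    rw [zero_mul] at h1 h2
    exact add_nonneg (mul_nonneg hform.Λ₁_nonneg h1) (mul_nonneg hform.Λ₂_nonneg h2)
  obtain ⟨v, hvaff, hvert⟩ := exists_interpolant h𝒯.conforming
    fun x => if u₂ x < u₁ x then (1 : ℝ) else 0
  have hone : ∀ T ∈ 𝒯, ∀ i, u₂ (T.points i) < u₁ (T.points i) → v (T.points i) = 1 :=
    fun T hT i h => by rw [hvert T hT, if_pos h]
  have hzero : ∀ T ∈ 𝒯, ∀ i, ¬u₂ (T.points i) < u₁ (T.points i) → v (T.points i) = 0 :=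
    fun T hT i h => by rw [hvert T hT, if_neg h]
  have hvertD : ∀ T ∈ 𝒯, ∀ i, T.points i ∈ ΓD → v (T.points i) = 0 := fun T hT i h =>
    hzero T hT i (by rw [h₁.1.2 _ h, h₂.1.2 _ h]; exact lt_irrefl _)
  have hcov : ∀ x ∈ closure Ω, ∃ T ∈ 𝒯, x ∈ T.closedInterior := fun _ => h𝒯.exists_mem
  have hsubset : ∀ T ∈ 𝒯, T.closedInterior ⊆ closure Ω := fun T hT => by
    rw [h𝒯.cover]; exact subset_biUnion_of_mem (u := fun T => T.closedInterior) hT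
  obtain ⟨ℰ, hℰ, hΓ⟩ := hΓD.captured
  have hvmem : v ∈ FESpaceNonneg Ω 𝒯 ΓD := by
    refine ⟨⟨hvaff, fun x hx => ?_⟩, fun x hx => ?_⟩
    · have hx' := hx
      rw [hΓ] at hx'
      obtain ⟨e, he, hxe⟩ := hx'
      obtain ⟨-, T, hT, i, j, -, rfl⟩ := hℰ he
      obtain ⟨L, hL⟩ := hvaff T hT
      -- The whole mesh edge lies in `ΓD`, so `v` vanishes at both of its endpoints and, being
      -- affine, on the edge.
      have hseg : segment ℝ (T.points i) (T.points j) ⊆ ΓD := by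
        rw [hΓ]; exact subset_sUnion_of_mem he
      have hsegT := (convex_closedInterior T).segment_subset (T.point_mem_closedInterior i)
        (T.point_mem_closedInterior j)
      have hLi : L (T.points i) = 0 := by
        rw [← hL _ (T.point_mem_closedInterior i)]
        exact hvertD T hT i (hseg (left_mem_segment ℝ _ _))
      have hLj : L (T.points j) = 0 := by
        rw [← hL _ (T.point_mem_closedInterior j)]
        exact hvertD T hT j (hseg (right_mem_segment ℝ _ _))
      rw [hL x (hsegT hxe)]
      exact ((convex_singleton (0 : ℝ)).affine_preimage L).segment_subset hLi hLj hxe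
    · obtain ⟨T, hT, hxT⟩ := hcov x (subset_closure hx)
      obtain ⟨L, hL⟩ := hvaff T hT
      rw [hL x hxT]
      refine AffineMap.ge_of_vertices (fun i => ?_) hxT
      rw [← hL _ (T.point_mem_closedInterior i), hvert T hT]
      split_ifs <;> norm_num
  obtain ⟨hint₁, hres₁⟩ := h₁.2 v hvmem
  obtain ⟨hint₂, hres₂⟩ := h₂.2 v hvmem
  have hsign : ∀ T ∈ 𝒯, ∀ x ∈ interior T.closedInterior,
      RegularAt A b lam₀ (Λ₁ * Cf + Λ₂ * Cg) Kη Bη x →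
      0 ≤ weakIntegrand A b u₁ v x - weakIntegrand A b u₂ v x ∧
      ((∀ i, v (T.points i) = 1) ∨ (∀ i, v (T.points i) = 0) ∨
        0 < weakIntegrand A b u₁ v x - weakIntegrand A b u₂ v x) := by
    intro T hT x hx hreg
    obtain ⟨L₁, hL₁⟩ := h₁.1.1 T hT
    obtain ⟨L₂, hL₂⟩ := h₂.1.1 T hT
    obtain ⟨L, hL⟩ := hvaff T hT
    exact weakIntegrand_sub_sign hform.lam₀_pos hcoeff.Kη_pos.le hcoeff.Bη_nonneg hC hx hreg hu
      hL₁ hL₂ hL (hM T hT) (hone T hT) (hzero T hT)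
  have hreg := ae_regularAt h𝒯.isOpen.measurableSet hcoeff hform
  have hnonneg : 0 ≤ᵐ[volume.restrict Ω]
      fun x => weakIntegrand A b u₁ v x - weakIntegrand A b u₂ v x := by
    filter_upwards [hreg, ae_mem_interior h𝒯] with x hx ⟨T, hT, hxT⟩
    exact (hsign T hT x hxT hx).1
  have hle : ∫ x in Ω, (weakIntegrand A b u₁ v x - weakIntegrand A b u₂ v x) ≤ 0 := by
    rw [integral_sub hint₁ hint₂]
    simp only [residual] at hres₁ hres₂
    linarith
  have hae := (integral_eq_zero_iff_of_nonneg_ae hnonneg (hint₁.sub hint₂)).1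
    (le_antisymm hle (integral_nonneg_of_ae hnonneg))
  have hconst : ∀ T ∈ 𝒯, (∀ x ∈ T.closedInterior, v x = 1) ∨ ∀ x ∈ T.closedInterior, v x = 0 := by
    intro T hT
    obtain ⟨L, hL⟩ := hvaff T hT
    have hne : (Ω ∩ interior T.closedInterior).Nonempty := by
      obtain ⟨y, hy⟩ := interior_closedInterior_nonempty T
      rw [inter_comm]
      exact mem_closure_iff.1 (hsubset T hT (interior_subset hy)) _ isOpen_interior hy
    -- A nonempty open subset of `Ω` has positive measure, so each triangle has an interior point
    -- where the integrand difference vanishes and the coefficients are regular. One such point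
    -- decides the triangle.
    have hfreq : ∃ᵐ x ∂volume.restrict Ω, x ∈ interior T.closedInterior := by
      rw [Filter.Frequently, ← measure_eq_zero_iff_ae_notMem,
        Measure.restrict_apply isOpen_interior.measurableSet, inter_comm]
      exact ((h𝒯.isOpen.inter isOpen_interior).measure_pos volume hne).ne'
    obtain ⟨x, hxT, hx, h0⟩ := (hfreq.and_eventually (hreg.and hae)).exists
    rcases (hsign T hT x hxT hx).2 with h | h | h
    · exact Or.inl fun y hy => eq_of_vertices hL h hy
    · exact Or.inr fun y hy => eq_of_vertices hL h hy
    · exact absurd h0 h.ne'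
  obtain ⟨p, hp, hvp⟩ : ∃ p ∈ closure Ω, v p = 0 := by
    obtain ⟨x, hx⟩ := nonempty_of_measure_ne_zero hΓD.pos.ne'
    have hx' := hx
    rw [hΓ] at hx'
    obtain ⟨e, he, -⟩ := hx'
    obtain ⟨hfr, -⟩ := hℰ he
    obtain ⟨y, hye⟩ : e.Nonempty := by
      obtain ⟨-, T, -, i, j, -, rfl⟩ := hℰ he
      exact ⟨_, left_mem_segment ℝ _ _⟩
    exact ⟨y, frontier_subset_closure (hfr hye),
      hvmem.1.2 y (hΓ ▸ subset_sUnion_of_mem he hye)⟩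
  have hv := forall_zero_of_zero_or_one h𝒯 hconst hp hvp
  intro x hx
  obtain ⟨T, hT, hxT⟩ := hcov x (subset_closure hx)
  obtain ⟨L₁, hL₁⟩ := h₁.1.1 T hT
  obtain ⟨L₂, hL₂⟩ := h₂.1.1 T hT
  rw [hL₁ x hxT, hL₂ x hxT, ← sub_nonpos]
  refine AffineMap.le_of_vertices (L := L₁ - L₂) (fun i => ?_) hxT
  have hi := T.point_mem_closedInterior i
  by_contra hlt
  have h1 : u₂ (T.points i) < u₁ (T.points i) := by
    rw [hL₁ _ hi, hL₂ _ hi]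
    exact sub_pos.1 (not_le.1 hlt)
  have h2 := hone T hT i h1
  rw [hv _ (hsubset T hT hi)] at h2
  norm_num at h2

lemma IsDiscreteSolution.isSubsolution {ψ u : Plane → ℝ}
    (h : IsDiscreteSolution Ω 𝒯 ΓD A b ψ u) : IsSubsolution Ω 𝒯 ΓD A b ψ u :=
  ⟨h.1, fun v hv => ⟨(h.2 v hv.1).1, (h.2 v hv.1).2.le⟩⟩

lemma IsDiscreteSolution.isSupersolution {ψ u : Plane → ℝ}
    (h : IsDiscreteSolution Ω 𝒯 ΓD A b ψ u) : IsSupersolution Ω 𝒯 ΓD A b ψ u :=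
  ⟨h.1, fun v hv => ⟨(h.2 v hv.1).1, (h.2 v hv.1).2.ge⟩⟩

end

end P1Comparison

theorem theorem4p5
    (Ω : Set Plane) (𝒯 : Finset (Affine.Triangle ℝ Plane)) (ΓD : Set Plane)
    (h𝒯 : IsTriangulation Ω 𝒯) (hΓD : IsDirichletPart Ω 𝒯 ΓD)
    (tmin tmax : ℝ) (hreg : MeshRegular 𝒯 tmin tmax)
    (A : Plane → ℝ → Plane → ℝ) (b : Plane → ℝ → ℝ) (γa Kη Bη : ℝ)
    (hcoeff : CoefficientAssumptions Ω A b γa Kη Bη)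
    (A₀ A₁ : Plane → ℝ → ℝ) (A₂ : Plane → ℝ) (f g : ℝ → ℝ) (lam₀ Λ₁ Λ₂ Cf Cg : ℝ)
    (hform : DiffusionForm Ω A A₀ A₁ A₂ f g lam₀ Λ₁ Λ₂ Cf Cg)
    (ψ : Plane → ℝ) (hψ_meas : AEMeasurable ψ (μH[1].restrict (frontier Ω \ ΓD)))
    (hψ_bdd : ∃ C : ℝ, ∀ x ∈ frontier Ω \ ΓD, |ψ x| ≤ C)
    (hpos : 0 < lam₀ * Real.cos tmax - Λ₁ * Cf - Λ₂ * Cg) :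
    -- the comparison principle
    (∀ u₁ u₂ : Plane → ℝ, IsSubsolution Ω 𝒯 ΓD A b ψ u₁ → IsSupersolution Ω 𝒯 ΓD A b ψ u₂ →
      MeshCondition 𝒯 lam₀ Λ₁ Λ₂ Cf Cg γa Kη Bη u₂ → ∀ x ∈ Ω, u₁ x ≤ u₂ x) ∧
    -- uniqueness of the discrete solution
    (∀ u u' : Plane → ℝ, IsDiscreteSolution Ω 𝒯 ΓD A b ψ u → IsDiscreteSolution Ω 𝒯 ΓD A b ψ u' →
      MeshCondition 𝒯 lam₀ Λ₁ Λ₂ Cf Cg γa Kη Bη u → ∀ x ∈ Ω, u' x = u x) := by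
  -- Uniqueness applies the comparison in both orders; `u` satisfies the mesh condition once as
  -- supersolution and once as subsolution.
  refine ⟨fun u₁ u₂ h₁ h₂ hM => le_of_meshCondition h𝒯 hΓD hcoeff hform h₁ h₂ (Or.inr rfl) hM,
    fun u u' hu hu' hM x hx => le_antisymm ?_ ?_⟩
  · exact le_of_meshCondition h𝒯 hΓD hcoeff hform hu'.isSubsolution hu.isSupersolution
      (Or.inr rfl) hM x hx
  · exact le_of_meshCondition h𝒯 hΓD hcoeff hform hu.isSubsolution hu'.isSupersolution
      (Or.inl rfl) hM x hx
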